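/- Let $r\ge 1$ and let $F$ be a free group of rank $r$ with free basis $B$. For $g\in F$ let $|g|$ be the word length of $g$ with respect to $B$, i.e. the distance from $1$ to $g$ in the Cayley graph of $F$ with respect to $B$, which is the $2r$-regular tree. For a subgroup $H\le F$ let $f_H(n)$ be the number of $h\in H$ with $|h|\le n$; a real number $b$ is the growth rate of $H$ if $b=\lim_{n\to\infty} f_H(n)^{1/n}$. Then the set of all growth rates of finitely generated subgroups of $F$ is a dense subset of $[1,2r-1]$; that is, it is contained in $[1,2r-1]$, and its closure contains $[1,2r-1]$. -/

import Mathlib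

open Filter Topology

namespace GroupGrowth

/-- The length of `g` with respect to a generating set `S`: the least length of a word in the
elements of `S` and their inverses that represents `g`, that is, the distance from `1` to `g` in the
Cayley graph. (It is only used for sets `S` that generate the group.) -/
noncomputable def wordLength {G : Type*} [Group G] (S : Set G) (g : G) : ℕ :=
  sInf {n : ℕ | ∃ l : List G, l.length = n ∧ (∀ x ∈ l, x ∈ S ∨ x⁻¹ ∈ S) ∧ l.prod = g}

/-- `f_H(n)`: the number of elements of the subgroup `H` whose length in the ambient group `G`,
with respect to the generating set `S` of `G`, is at most `n`. (The set that is counted is finite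
when `S` is finite and generates `G`.) -/
noncomputable def growthFunction {G : Type*} [Group G] (S : Set G) (H : Subgroup G) (n : ℕ) : ℕ :=
  Set.ncard {g : G | g ∈ H ∧ wordLength S g ≤ n}

/-- `b` is the growth rate of `H` with respect to `S`: `f_H(n) ^ (1 / n)` converges to `b`. -/
def IsGrowthRate {G : Type*} [Group G] (S : Set G) (H : Subgroup G) (b : ℝ) : Prop :=
  Tendsto (fun n : ℕ => (growthFunction S H n : ℝ) ^ ((1 : ℝ) / (n : ℝ))) atTop (𝓝 b)

/-- The set of growth rates, with respect to `S`, of the finitely generated subgroups of `G`. -/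
def fgSubgroupGrowthRates {G : Type*} [Group G] (S : Set G) : Set ℝ :=
  {b : ℝ | ∃ H : Subgroup G, H.FG ∧ IsGrowthRate S H b}

end GroupGrowth

/-!
The subgroups are found among fundamental groups of subdivided Cayley graphs. Let `π` be a
homomorphism from the free group onto a finite group `Q`, and let the edge `(q, s)` of the Cayley
graph of `Q` be replaced by a path of `ℓ (q, s)` edges that all carry the letter `s`. The labels of
the closed paths at `1` form a subgroup, the image of `ker π` under `spellHom`. It is finitely
generated because `ker π` has finite index, and the length of an element is the length of the
corresponding nonbacktracking walk because no cancellation occurs. Its growth rate is therefore the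
Perron eigenvalue `lam` of the nonbacktracking operator with edge weights `lam⁻¹ ^ ℓ`
(`tendsto_ncard_closedWalkSet`, `mem_fgSubgroupGrowthRates`).

If all lengths are `1`, then `lam = 2 r - 1`. The lengths are then increased one edge at a time. The
Perron eigenvector and its composition with the reversal of edges define a stationary Markov chain,
and Jensen's inequality for this chain (`IsPerron.log_mul_sum_le`) shows that lengthening an edge
that carries at most the proportion `ε` of the stationary mass divides `log lam` by at most `1 + ε`.
So `log lam` descends in small steps as long as a short edge of small mass exists. If there is none,
then there are fewer than `G` short edges, where `G` exceeds `2 / ε`. When the Cayley graph has girth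
larger than `G`, walks of `G` edges do not repeat edges, hence each contains a long edge, and `lam`
is already close to `1` (`IsPerron.exists_short_edge_mass_le`). A finite quotient of large girth
exists since free groups are residually finite (`exists_finite_quotient`). Hence each
`x` in `(1, 2 r - 1]` has a growth rate between `x` and `x ^ (1 + ε)` (`exists_growthRate_between`);
the trivial subgroup has the rate `1`.

The bounds `1` and `2 r - 1` hold because a subgroup contains `1` and is contained in the whole
group, whose growth is the case of the trivial quotient (`mem_Icc_of_isGrowthRate`).
-/

namespace GroupGrowth

/-! ### Perron eigenvectors of weighted nonbacktracking systems -/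

/-- The combinatorics of the directed edges of a finite `(d + 1)`-regular graph: `Follows g e` says
that a nonbacktracking walk may cross `e` right after `g`, and `rev` reverses an edge. Only the
number of predecessors is recorded; the number of successors is the same by reversal. -/
structure EdgeSystem (E : Type*) [Fintype E] (d : ℕ) where
  /-- `e` may directly follow `g` in a nonbacktracking walk. -/
  Follows : E → E → Prop
  /-- The same edge with the opposite orientation. -/
  rev : E → E
  rev_rev : ∀ e, rev (rev e) = e
  follows_rev : ∀ {g e}, Follows g e → Follows (rev e) (rev g)
  card_pred : ∀ e, Nat.card {g // Follows g e} = d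

namespace EdgeSystem

variable {E : Type*} [Fintype E] {d : ℕ} (S : EdgeSystem E d)

open Classical in
/-- The edges that may directly precede `e` in a nonbacktracking walk. -/
noncomputable def pred (e : E) : Finset E := Finset.univ.filter (S.Follows · e)

/-- Any directed edge can be reached from any other by a nonbacktracking walk. -/
def Irreducible : Prop := ∀ e f, Relation.TransGen S.Follows e f

/-- `y` is a positive eigenvector of the nonbacktracking operator in which crossing an edge `e` of
length `ℓ e` has the weight `lam⁻¹ ^ ℓ e`, for the eigenvalue `1`. -/
structure IsPerron (ℓ : E → ℕ) (lam : ℝ) (y : E → ℝ) : Prop where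
  pos : ∀ e, 0 < y e
  eq : ∀ e, lam ^ ℓ e * y e = ∑ g ∈ S.pred e, y g

@[simp]
lemma mem_pred {g e : E} : g ∈ S.pred e ↔ S.Follows g e := by simp [pred]

lemma card_pred_eq (e : E) : (S.pred e).card = d := by
  classical
  have := S.card_pred e
  rwa [Nat.card_eq_fintype_card, Fintype.card_subtype] at this

lemma mem_pred_rev {g e : E} : S.rev e ∈ S.pred (S.rev g) ↔ g ∈ S.pred e := by
  simp only [mem_pred]
  refine ⟨fun h => ?_, S.follows_rev⟩
  simpa [S.rev_rev] using S.follows_rev h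

/-- Reversal as a permutation of the directed edges. -/
def revEquiv : E ≃ E := ⟨S.rev, S.rev, S.rev_rev, S.rev_rev⟩

/-- Double counting of the pairs of consecutive edges: the successors of `g` are the reversals of
the predecessors of `rev g`. -/
lemma sum_sum_pred (a b : E → ℝ) :
    ∑ e, a e * ∑ g ∈ S.pred e, b g = ∑ g, b g * ∑ f ∈ S.pred (S.rev g), a (S.rev f) := by
  classical
  have h1 : ∀ e, a e * ∑ g ∈ S.pred e, b g = ∑ g, if g ∈ S.pred e then a e * b g else 0 := by
    intro e
    rw [Finset.mul_sum, ← Finset.sum_filter]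
    congr 1
    ext g; simp
  have h2 : ∀ g, b g * ∑ f ∈ S.pred (S.rev g), a (S.rev f)
      = ∑ e, if g ∈ S.pred e then a e * b g else 0 := by
    intro g
    rw [← S.revEquiv.sum_comp (fun e => if g ∈ S.pred e then a e * b g else 0), Finset.mul_sum, ← Finset.sum_filter]
    refine Finset.sum_congr (Finset.ext fun f => ?_) fun f _ => mul_comm _ _
    have := S.mem_pred_rev (g := g) (e := S.rev f)
    rw [S.rev_rev] at this
    rw [this]
    exact ⟨fun h => Finset.mem_filter.2 ⟨Finset.mem_univ _, h⟩, fun h => (Finset.mem_filter.1 h).2⟩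
  rw [Finset.sum_congr rfl fun e _ => h1 e, Finset.sum_congr rfl fun g _ => h2 g,
    Finset.sum_comm]

lemma sum_sum_pred_eq (y : E → ℝ) : ∑ e, ∑ g ∈ S.pred e, y g = d * ∑ e, y e := by
  have := S.sum_sum_pred (fun _ => 1) y
  simp only [one_mul, Finset.sum_const, card_pred_eq, nsmul_eq_mul, mul_one] at this
  rw [this, Finset.mul_sum]
  exact Finset.sum_congr rfl fun e _ => mul_comm _ _

/-- A supersolution that is strict at one edge, together with irreducibility, yields supersolutions
that are strict everywhere: applying the operator moves strictness along `Follows`, and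
supersolutions can be added. -/
lemma exists_strict_supersolution (hS : S.Irreducible) {ℓ : E → ℕ} {lam : ℝ} (hlam : 0 < lam)
    {y : E → ℝ} (hy : ∀ e, 0 ≤ y e) (hsup : ∀ e, ∑ g ∈ S.pred e, y g ≤ lam ^ ℓ e * y e)
    {e₀ : E} (he₀ : ∑ g ∈ S.pred e₀, y g < lam ^ ℓ e₀ * y e₀) :
    ∃ u : E → ℝ, (∀ e, 0 ≤ u e) ∧ ∀ e, ∑ g ∈ S.pred e, u g < lam ^ ℓ e * u e := by
  have key : ∀ e, ∃ u : E → ℝ, (∀ f, 0 ≤ u f) ∧ (∀ f, ∑ g ∈ S.pred f, u g ≤ lam ^ ℓ f * u f) ∧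
      ∑ g ∈ S.pred e, u g < lam ^ ℓ e * u e := by
    intro e
    have step : ∀ a b, S.Follows a b →
        (∃ u : E → ℝ, (∀ f, 0 ≤ u f) ∧ (∀ f, ∑ g ∈ S.pred f, u g ≤ lam ^ ℓ f * u f) ∧
          ∑ g ∈ S.pred a, u g < lam ^ ℓ a * u a) →
        (∃ u : E → ℝ, (∀ f, 0 ≤ u f) ∧ (∀ f, ∑ g ∈ S.pred f, u g ≤ lam ^ ℓ f * u f) ∧
          ∑ g ∈ S.pred b, u g < lam ^ ℓ b * u b) := by
      rintro a b hab ⟨u, hu0, hu, hua⟩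
      have hv : ∀ f, lam ^ ℓ f * ((lam ^ ℓ f)⁻¹ * ∑ g ∈ S.pred f, u g) = ∑ g ∈ S.pred f, u g :=
        fun f => mul_inv_cancel_left₀ (pow_pos hlam _).ne' _
      have hle : ∀ g, (lam ^ ℓ g)⁻¹ * ∑ g' ∈ S.pred g, u g' ≤ u g := fun g => by
        rw [inv_mul_le_iff₀ (pow_pos hlam _)]; exact hu g
      refine ⟨fun f => (lam ^ ℓ f)⁻¹ * ∑ g ∈ S.pred f, u g, fun f => ?_, fun f => ?_, ?_⟩
      · exact mul_nonneg (inv_nonneg.2 (pow_pos hlam _).le) (Finset.sum_nonneg fun g _ => hu0 g)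
      · rw [hv]; exact Finset.sum_le_sum fun g _ => hle g
      · rw [hv]
        refine Finset.sum_lt_sum (fun g _ => hle g) ⟨a, by simpa using hab, ?_⟩
        rw [inv_mul_lt_iff₀ (pow_pos hlam _)]; exact hua
    have h := hS e₀ e
    induction h with
    | single hab => exact step _ _ hab ⟨y, hy, hsup, he₀⟩
    | tail _ hab ih => exact step _ _ hab ih
  choose u hu0 hu hus using key
  refine ⟨fun f => ∑ e, u e f, fun f => Finset.sum_nonneg fun e _ => hu0 e f, fun f => ?_⟩
  rw [Finset.sum_comm, Finset.mul_sum]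
  exact Finset.sum_lt_sum (fun e _ => hu e f) ⟨f, Finset.mem_univ _, hus f⟩

/-- Perron–Frobenius for edge systems. The eigenvalue is the least `lam` that admits a
supersolution; minimality excludes strict supersolutions. -/
theorem exists_isPerron [Nonempty E] (hS : S.Irreducible) (hd : 2 ≤ d) (ℓ : E → ℕ)
    (hℓ : ∀ e, 1 ≤ ℓ e) : ∃ lam : ℝ, 1 < lam ∧ ∃ y, S.IsPerron ℓ lam y := by
  classical
  have hd' : (2 : ℝ) ≤ d := by exact_mod_cast hd
  set K : Set (ℝ × (E → ℝ)) := (Set.Icc 1 (d : ℝ) ×ˢ stdSimplex ℝ E) ∩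
    {p | ∀ e, ∑ g ∈ S.pred e, p.2 g ≤ p.1 ^ ℓ e * p.2 e} with hK
  have hcomp : IsCompact K := by
    refine (isCompact_Icc.prod (isCompact_stdSimplex ℝ E)).inter_right ?_
    rw [Set.ofPred_forall]
    exact isClosed_iInter fun e => isClosed_le (by fun_prop) (by fun_prop)
  have hne : K.Nonempty := by
    refine ⟨(d, fun _ => (Fintype.card E : ℝ)⁻¹), ⟨⟨by simp; linarith, ?_⟩, ?_⟩⟩
    · exact ⟨fun _ => by positivity, by simp⟩
    · intro e
      simp only [Finset.sum_const, card_pred_eq, nsmul_eq_mul]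
      refine mul_le_mul_of_nonneg_right ?_ (by positivity)
      exact le_self_pow₀ (by linarith) (by have := hℓ e; omega)
  obtain ⟨⟨lam, y⟩, hmem, hmin⟩ := hcomp.exists_isMinOn hne continuous_fst.continuousOn
  obtain ⟨⟨⟨hlam1, hlamd⟩, hy0, hysum⟩, hsup⟩ := hmem
  simp only [Set.mem_ofPred_eq] at hlam1 hlamd hy0 hysum hsup
  have hmin' : ∀ p ∈ K, lam ≤ p.1 := fun p hp => hmin hp
  have hlampos : 0 < lam := by linarith
  have hlam : 1 < lam := by
    refine lt_of_le_of_ne hlam1 fun h => ?_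
    have h1 : ∑ e, ∑ g ∈ S.pred e, y g ≤ ∑ e, y e :=
      Finset.sum_le_sum fun e _ => by simpa [← h] using hsup e
    rw [S.sum_sum_pred_eq, hysum] at h1
    linarith
  obtain ⟨e₁, he₁⟩ : ∃ e, 0 < y e := by
    by_contra! h
    have : ∑ e, y e ≤ 0 := Finset.sum_nonpos fun e _ => h e
    linarith
  have hstep : ∀ a b, S.Follows a b → 0 < y a → 0 < y b := fun a b hab ha => by
    have h1 : y a ≤ ∑ g ∈ S.pred b, y g :=
      Finset.single_le_sum (f := y) (fun g _ => hy0 g) (by simpa using hab)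
    exact pos_of_mul_pos_right ((ha.trans_le h1).trans_le (hsup b)) (by positivity)
  have hpos : ∀ e, 0 < y e := fun e => by
    have h := hS e₁ e
    induction h with
    | single hab => exact hstep _ _ hab he₁
    | tail _ hab ih => exact hstep _ _ hab ih
  refine ⟨lam, hlam, y, hpos, fun e => ?_⟩
  by_contra hneq
  obtain ⟨u, hu0, hu⟩ := S.exists_strict_supersolution hS hlampos hy0 hsup
    (lt_of_le_of_ne (hsup e) (Ne.symm hneq))
  -- A supersolution that is strict everywhere survives a small decrease of `lam`.
  have hev : ∀ᶠ m in 𝓝[<] lam, ∀ e, ∑ g ∈ S.pred e, u g < m ^ ℓ e * u e := by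
    refine eventually_all.2 fun e => nhdsWithin_le_nhds ?_
    have hc : Continuous fun m : ℝ => m ^ ℓ e * u e := by fun_prop
    exact hc.continuousAt.eventually (lt_mem_nhds (hu e))
  have hev2 : ∀ᶠ m in 𝓝[<] lam, m ∈ Set.Ioo 1 lam := Ioo_mem_nhdsLT hlam
  obtain ⟨m, hm, hm1, hm2⟩ := (hev.and hev2).exists
  have hU : 0 < ∑ e, u e := by
    refine Finset.sum_pos' (fun e _ => hu0 e) ⟨e, Finset.mem_univ _, ?_⟩
    exact pos_of_mul_pos_right ((Finset.sum_nonneg fun g _ => hu0 g).trans_lt (hu e))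
      (by positivity)
  have := hmin' (m, fun e => (∑ e, u e)⁻¹ * u e) ⟨⟨⟨hm1.le, by linarith⟩,
    fun e => mul_nonneg (inv_nonneg.2 hU.le) (hu0 e), by
      simp only; rw [← Finset.mul_sum, inv_mul_cancel₀ hU.ne']⟩, fun e => by
      simp only
      rw [← Finset.mul_sum, mul_left_comm]
      exact mul_le_mul_of_nonneg_left (hm e).le (inv_nonneg.2 hU.le)⟩
  simp only at this
  linarith

variable {S}

/-- The stationary mass of an edge: the product of the right and the left Perron eigenvectors, the
left one being obtained from the right one by reversal. -/
noncomputable def mass (S : EdgeSystem E d) (ℓ : E → ℕ) (lam : ℝ) (y : E → ℝ) (e : E) : ℝ :=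
  lam ^ ℓ e * y e * y (S.rev e)

lemma IsPerron.mass_pos {ℓ : E → ℕ} {lam : ℝ} {y : E → ℝ} (h : S.IsPerron ℓ lam y)
    (hlam : 0 < lam) (e : E) : 0 < S.mass ℓ lam y e :=
  mul_pos (mul_pos (pow_pos hlam _) (h.pos e)) (h.pos _)

lemma mass_rev {ℓ : E → ℕ} {lam : ℝ} {y : E → ℝ} (hrev : ∀ e, ℓ (S.rev e) = ℓ e) (e : E) :
    S.mass ℓ lam y (S.rev e) = S.mass ℓ lam y e := by
  simp only [mass, hrev, S.rev_rev]; ring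

/-- Comparison of entropies for two length functions: Jensen's inequality for the stationary Markov
chain of the first one. -/
theorem IsPerron.log_mul_sum_le {ℓ ℓ' : E → ℕ} {lam lam' : ℝ} {y y' : E → ℝ}
    (h : S.IsPerron ℓ lam y) (h' : S.IsPerron ℓ' lam' y') (hrev : ∀ e, ℓ (S.rev e) = ℓ e)
    (hlam : 0 < lam) (hlam' : 0 < lam') :
    Real.log lam * ∑ e, S.mass ℓ lam y e * ℓ e ≤
      Real.log lam' * ∑ e, S.mass ℓ lam y e * ℓ' e := by
  -- `w` is the new eigenvector relative to the old one.
  set w : E → ℝ := fun e => y' e / y e with hw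
  have hwpos : ∀ e, 0 < w e := fun e => div_pos (h'.pos e) (h.pos e)
  have hjensen : ∀ e, (lam ^ ℓ e * y e)⁻¹ * ∑ g ∈ S.pred e, y g * Real.log (w g) ≤
      Real.log (w e) + ℓ' e * Real.log lam' - ℓ e * Real.log lam := by
    intro e
    have hA : 0 < lam ^ ℓ e * y e := mul_pos (pow_pos hlam _) (h.pos e)
    have h1 := strictConcaveOn_log_Ioi.concaveOn.le_map_sum (t := S.pred e)
      (w := fun g => (lam ^ ℓ e * y e)⁻¹ * y g) (p := w)
      (fun g _ => mul_nonneg (inv_nonneg.2 hA.le) (h.pos g).le)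
      (by rw [← Finset.mul_sum, ← h.eq, inv_mul_cancel₀ hA.ne']) (fun g _ => hwpos g)
    simp only [smul_eq_mul, mul_assoc, ← Finset.mul_sum] at h1
    have h2 : ∑ g ∈ S.pred e, y g * w g = lam' ^ ℓ' e * y' e := by
      rw [h'.eq]
      exact Finset.sum_congr rfl fun g _ => mul_div_cancel₀ _ (h.pos g).ne'
    rw [h2] at h1
    have h3 : (lam ^ ℓ e * y e)⁻¹ * (lam' ^ ℓ' e * y' e) = w e * lam' ^ ℓ' e / lam ^ ℓ e := by
      have := (h.pos e).ne'
      have := (pow_pos hlam (ℓ e)).ne'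
      simp only [hw]
      field_simp
    have h4 := (pow_pos hlam (ℓ e)).ne'
    have h5 := (pow_pos hlam' (ℓ' e)).ne'
    rw [h3, Real.log_div (mul_ne_zero (hwpos e).ne' h5) h4, Real.log_mul (hwpos e).ne' h5,
      Real.log_pow, Real.log_pow] at h1
    exact h1
  have hsum := Finset.sum_le_sum fun e (_ : e ∈ Finset.univ) =>
    mul_le_mul_of_nonneg_left (hjensen e) (h.mass_pos hlam e).le
  -- By stationarity the terms with `log (w e)` cancel.
  have hstat : ∑ e, S.mass ℓ lam y e *
      ((lam ^ ℓ e * y e)⁻¹ * ∑ g ∈ S.pred e, y g * Real.log (w g)) =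
      ∑ e, S.mass ℓ lam y e * Real.log (w e) := by
    have h1 : ∀ e, S.mass ℓ lam y e *
        ((lam ^ ℓ e * y e)⁻¹ * ∑ g ∈ S.pred e, y g * Real.log (w g)) =
        y (S.rev e) * ∑ g ∈ S.pred e, y g * Real.log (w g) := fun e => by
      have hA : lam ^ ℓ e * y e ≠ 0 := (mul_pos (pow_pos hlam _) (h.pos e)).ne'
      rw [mass, mul_right_comm, mul_inv_cancel_left₀ hA, mul_comm]
    rw [Finset.sum_congr rfl fun e _ => h1 e, S.sum_sum_pred]
    refine Finset.sum_congr rfl fun g _ => ?_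
    simp only [S.rev_rev]
    rw [← h.eq, hrev, mass]
    ring
  rw [hstat] at hsum
  simp only [mul_sub, mul_add, Finset.sum_add_distrib, Finset.sum_sub_distrib] at hsum
  rw [Finset.mul_sum, Finset.mul_sum]
  have e1 : ∑ e, S.mass ℓ lam y e * (ℓ' e * Real.log lam') =
      ∑ e, Real.log lam' * (S.mass ℓ lam y e * ℓ' e) :=
    Finset.sum_congr rfl fun e _ => by ring
  have e2 : ∑ e, S.mass ℓ lam y e * (ℓ e * Real.log lam) =
      ∑ e, Real.log lam * (S.mass ℓ lam y e * ℓ e) :=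
    Finset.sum_congr rfl fun e _ => by ring
  linarith

end EdgeSystem

/-! ### Reaching every growth rate by lengthening edges of small mass -/

namespace EdgeSystem

variable {E : Type*} [Fintype E] {d : ℕ} {S : EdgeSystem E d}

/-- If every backward walk of `j + 1` edges ending with `e` contains an edge of length at least `L`,
then the Perron eigenvector is small at `e`. -/
lemma IsPerron.pow_mul_le {ℓ : E → ℕ} {lam : ℝ} {y : E → ℝ} (h : S.IsPerron ℓ lam y)
    (hlam : 1 ≤ lam) (hd : 1 ≤ d) {M : ℝ} (hM : ∀ e, y e ≤ M) (L : ℕ) (j : ℕ) (e : E)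
    (hj : ∀ l : List E, (e :: l).IsChain (fun a b => S.Follows b a) →
      (∀ f ∈ e :: l, ℓ f < L) → l.length ≠ j) :
    lam ^ L * y e ≤ d ^ (j + 1) * M := by
  have hd' : (1 : ℝ) ≤ d := by exact_mod_cast hd
  have hM0 : 0 ≤ M := (h.pos e).le.trans (hM e)
  have hlong : ∀ e, L ≤ ℓ e → lam ^ L * y e ≤ d * M := fun e he => by
    calc lam ^ L * y e ≤ lam ^ ℓ e * y e :=
          mul_le_mul_of_nonneg_right (pow_le_pow_right₀ hlam he) (h.pos e).le
      _ = ∑ g ∈ S.pred e, y g := h.eq e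
      _ ≤ ∑ g ∈ S.pred e, M := Finset.sum_le_sum fun g _ => hM g
      _ = d * M := by simp [card_pred_eq]
  induction j generalizing e with
  | zero =>
    have : L ≤ ℓ e := by
      by_contra! hlt
      exact hj [] (by simp) (by simpa using hlt) rfl
    simpa using hlong e this
  | succ j ih =>
    rcases le_or_gt L (ℓ e) with he | he
    · refine (hlong e he).trans (mul_le_mul_of_nonneg_right ?_ hM0)
      exact le_self_pow₀ hd' (by omega)
    · have hg : ∀ g ∈ S.pred e, lam ^ L * y g ≤ d ^ (j + 1) * M := fun g hg => by
        refine ih g fun l hl hs hlen => hj (g :: l) ?_ ?_ (by simp [hlen])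
        · exact List.isChain_cons_cons.2 ⟨by simpa using hg, hl⟩
        · simpa [he] using hs
      calc lam ^ L * y e ≤ lam ^ L * (lam ^ ℓ e * y e) := by
            refine mul_le_mul_of_nonneg_left ?_ (by positivity)
            exact le_mul_of_one_le_left (h.pos e).le (one_le_pow₀ hlam)
        _ = ∑ g ∈ S.pred e, lam ^ L * y g := by rw [h.eq, Finset.mul_sum]
        _ ≤ ∑ g ∈ S.pred e, d ^ (j + 1) * M := Finset.sum_le_sum hg
        _ = d ^ (j + 1 + 1) * M := by
            simp only [Finset.sum_const, card_pred_eq, nsmul_eq_mul]; ring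

/-- In a system without short cycles, a Perron eigenvalue that is not small leaves some edge of
length less than `L` whose mass is at most the proportion `ε` of the total. Otherwise there are
fewer than `G` edges of length less than `L`, so every walk of `G` edges meets a long one. -/
lemma IsPerron.exists_short_edge_mass_le [Nonempty E] {ℓ : E → ℕ} {lam : ℝ} {y : E → ℝ}
    (h : S.IsPerron ℓ lam y) (hlam : 1 < lam) (hd : 1 ≤ d) (hrev : ∀ e, ℓ (S.rev e) = ℓ e)
    (hℓ : ∀ e, 1 ≤ ℓ e) {G L : ℕ} {ε : ℝ} (hG : 2 < ε * G)
    (hgirth : ∀ l : List E, l.IsChain (fun a b => S.Follows b a) → l.length = G → l.Nodup)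
    (hL : G * Real.log d < L * Real.log lam) :
    ∃ e, ℓ e < L ∧ S.mass ℓ lam y e + S.mass ℓ lam y (S.rev e) ≤
      ε * ∑ e, S.mass ℓ lam y e * ℓ e := by
  classical
  by_contra! hcon
  have hlam0 : 0 < lam := by linarith
  set m := S.mass ℓ lam y with hm
  have hmpos : ∀ e, 0 < m e := h.mass_pos hlam0
  set T := ∑ e, m e * ℓ e with hT
  have hmT : ∑ e, m e ≤ T := Finset.sum_le_sum fun e _ =>
    le_mul_of_one_le_right (hmpos e).le (by exact_mod_cast hℓ e)
  have hTpos : 0 < T :=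
    (Finset.sum_pos (fun e _ => hmpos e) Finset.univ_nonempty).trans_le hmT
  set s := Finset.univ.filter fun e => ℓ e < L with hs
  have hcard : s.card < G := by
    have h1 : s.card * (ε * T) ≤ ∑ e ∈ s, 2 * m e := by
      rw [← nsmul_eq_mul]
      refine Finset.card_nsmul_le_sum _ _ _ fun e he => ?_
      have h2 := hcon e (by simpa [hs] using he)
      rw [hm, mass_rev hrev, ← hm] at h2
      linarith
    have h2 : ∑ e ∈ s, 2 * m e ≤ 2 * T := by
      rw [← Finset.mul_sum]
      have := Finset.sum_le_univ_sum_of_nonneg (s := s) fun e => (hmpos e).le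
      linarith
    have h3 : (s.card : ℝ) * ε ≤ 2 := by
      refine le_of_mul_le_mul_right ?_ hTpos
      linarith
    have hε : 0 < ε := by
      by_contra! hε
      have : ε * G ≤ 0 := mul_nonpos_of_nonpos_of_nonneg hε (by positivity)
      linarith
    have h4 : ε * s.card < ε * G := by linarith
    exact_mod_cast lt_of_mul_lt_mul_left h4 hε.le
  obtain ⟨e, -, he⟩ := Finset.exists_max_image Finset.univ y Finset.univ_nonempty
  have hbound := h.pow_mul_le hlam.le hd (fun f => he f (Finset.mem_univ f)) L (G - 1) e
    fun l hl hshort hlen => by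
      have hlenG : (e :: l).length = G := by simp [hlen]; omega
      have hnd := hgirth _ hl hlenG
      have hsub : (e :: l).toFinset ⊆ s := fun f hf => by
        simpa [hs] using hshort f (List.mem_toFinset.1 hf)
      have := Finset.card_le_card hsub
      rw [List.toFinset_card_of_nodup hnd, hlenG] at this
      omega
  rw [Nat.sub_add_cancel (by omega)] at hbound
  have hpow := le_of_mul_le_mul_right hbound (h.pos e)
  have hlog := Real.log_le_log (by positivity) hpow
  rw [Real.log_pow, Real.log_pow] at hlog
  linarith

/-- Every target between `0` and `log d` is the logarithm of a Perron eigenvalue, up to the factor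
`1 + ε`, for suitable integer lengths. All lengths are `1` at the start; lengthening by `1` an edge
of relative mass at most `ε` divides the logarithm by at most `1 + ε`. -/
theorem exists_lengths [Nonempty E] (hS : S.Irreducible) (hd : 2 ≤ d) {X ε : ℝ} (hX : 0 < X)
    (hXd : X ≤ Real.log d) (hε : 0 < ε) {G : ℕ} (hG : 2 < ε * G)
    (hgirth : ∀ l : List E, l.IsChain (fun a b => S.Follows b a) → l.length = G → l.Nodup) :
    ∃ ℓ : E → ℕ, (∀ e, 1 ≤ ℓ e) ∧ (∀ e, ℓ (S.rev e) = ℓ e) ∧ ∃ lam : ℝ, 1 < lam ∧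
      (∃ y, S.IsPerron ℓ lam y) ∧ X ≤ Real.log lam ∧ Real.log lam ≤ (1 + ε) * X := by
  classical
  have hd' : (2 : ℝ) ≤ d := by exact_mod_cast hd
  obtain ⟨L, hL⟩ := exists_nat_gt (G * Real.log d / X)
  rw [div_lt_iff₀ hX] at hL
  suffices H : ∀ (N : ℕ) (ℓ : E → ℕ) (lam : ℝ) (y : E → ℝ), ∑ e, (L - ℓ e) = N →
      (∀ e, 1 ≤ ℓ e) → (∀ e, ℓ (S.rev e) = ℓ e) → 1 < lam → S.IsPerron ℓ lam y →
      X ≤ Real.log lam → ∃ ℓ : E → ℕ, (∀ e, 1 ≤ ℓ e) ∧ (∀ e, ℓ (S.rev e) = ℓ e) ∧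
        ∃ lam : ℝ, 1 < lam ∧ (∃ y, S.IsPerron ℓ lam y) ∧ X ≤ Real.log lam ∧
          Real.log lam ≤ (1 + ε) * X by
    refine H _ (fun _ => 1) d (fun _ => 1) rfl (fun _ => le_rfl) (fun _ => rfl) (by linarith)
      ⟨fun _ => one_pos, fun e => ?_⟩ hXd
    simp [card_pred_eq]
  intro N
  induction N using Nat.strong_induction_on with
  | _ N ih =>
  intro ℓ lam y hN hℓ hrev hlam h hlow
  rcases le_or_gt (Real.log lam) ((1 + ε) * X) with hup | hup
  · exact ⟨ℓ, hℓ, hrev, lam, hlam, ⟨y, h⟩, hlow, hup⟩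
  have hlam0 : 0 < lam := by linarith
  obtain ⟨e, heL, hmass⟩ := h.exists_short_edge_mass_le hlam (by omega) hrev hℓ hG hgirth
    (L := L) (hL.trans_le (mul_le_mul_of_nonneg_left hlow (by positivity)))
  set ℓ' : E → ℕ := fun f => ℓ f + if f = e ∨ f = S.rev e then 1 else 0 with hℓ'
  have hrev' : ∀ f, ℓ' (S.rev f) = ℓ' f := fun f => by
    have h1 : S.rev f = e ↔ f = S.rev e :=
      ⟨fun h => by rw [← h, S.rev_rev], fun h => by rw [h, S.rev_rev]⟩
    have h2 : S.rev f = S.rev e ↔ f = e :=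
      ⟨fun h => by rw [← S.rev_rev f, h, S.rev_rev], fun h => by rw [h]⟩
    simp only [hℓ', hrev, h1, h2, or_comm]
  have hone : ∀ f, 1 ≤ ℓ' f := fun f => (hℓ f).trans (Nat.le_add_right _ _)
  obtain ⟨lam', hlam', y', h'⟩ := S.exists_isPerron hS hd ℓ' hone
  refine ih (∑ f, (L - ℓ' f)) ?_ ℓ' lam' y' rfl hone hrev' hlam' h' ?_
  · rw [← hN]
    refine Finset.sum_lt_sum (fun f _ => Nat.sub_le_sub_left (Nat.le_add_right _ _) _)
      ⟨e, Finset.mem_univ _, ?_⟩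
    simp only [hℓ', true_or, if_true]
    omega
  · set m := S.mass ℓ lam y with hm
    have hmpos : ∀ e, 0 < m e := h.mass_pos hlam0
    set T := ∑ e, m e * ℓ e with hT
    have hTpos : 0 < T := Finset.sum_pos
      (fun f _ => mul_pos (hmpos f) (by exact_mod_cast hℓ f)) Finset.univ_nonempty
    have hcmp := h.log_mul_sum_le h' hrev hlam0 (by linarith)
    have hT' : ∑ f, m f * ℓ' f ≤ (1 + ε) * T := by
      have h1 : ∀ f, m f * ℓ' f ≤
          m f * ℓ f + ((if f = e then m f else 0) + if f = S.rev e then m f else 0) := fun f => by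
        have := (hmpos f).le
        simp only [hℓ']
        split_ifs with h1 h2 h3 <;> push_cast <;> first | linarith | simp_all
      calc ∑ f, m f * ℓ' f ≤ _ := Finset.sum_le_sum fun f _ => h1 f
        _ = T + (m e + m (S.rev e)) := by simp [Finset.sum_add_distrib, hT]
        _ ≤ (1 + ε) * T := by linarith
    have hlog' : 0 < Real.log lam' := Real.log_pos hlam'
    have h2 : Real.log lam * T ≤ (Real.log lam' * (1 + ε)) * T := by
      refine hcmp.trans ?_
      rw [mul_assoc]
      exact mul_le_mul_of_nonneg_left hT' hlog'.le
    have h3 := le_of_mul_le_mul_right h2 hTpos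
    have h4 : X * (1 + ε) < Real.log lam' * (1 + ε) := by linarith
    exact (lt_of_mul_lt_mul_right h4 (by linarith)).le

end EdgeSystem

/-! ### Exponential bounds for counting recursions -/

lemma tendsto_const_mul_pow_root {lam c : ℝ} (hlam : 0 < lam) (hc : 0 < c) :
    Tendsto (fun n : ℕ => (c * lam ^ n) ^ ((1 : ℝ) / (n : ℝ))) atTop (𝓝 lam) := by
  have h1 : Tendsto (fun n : ℕ => c ^ ((1 : ℝ) / (n : ℝ)) * lam) atTop (𝓝 lam) := by
    have h0 := (Real.continuousAt_const_rpow hc.ne').tendsto.comp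
      tendsto_one_div_atTop_nhds_zero_nat
    simpa using h0.mul_const lam
  refine h1.congr' ?_
  filter_upwards [eventually_ne_atTop 0] with n hn
  rw [Real.mul_rpow hc.le (pow_pos hlam n).le, one_div, Real.pow_rpow_inv_natCast hlam.le hn]

lemma tendsto_const_mul_succ_mul_pow_root {lam C : ℝ} (hlam : 0 < lam) (hC : 0 < C) :
    Tendsto (fun n : ℕ => (C * ((n : ℝ) + 1) * lam ^ n) ^ ((1 : ℝ) / (n : ℝ))) atTop (𝓝 lam) := by
  have h1 : Tendsto (fun n : ℕ => ((n : ℝ) + 1) ^ ((1 : ℝ) / (n : ℝ))) atTop (𝓝 1) := by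
    have h0 := (tendsto_rpow_div_mul_add 1 1 (-1) one_ne_zero.symm).comp
      (tendsto_atTop_add_const_right _ (1 : ℝ) tendsto_natCast_atTop_atTop)
    refine h0.congr fun n => ?_
    simp
  have h2 := h1.mul (tendsto_const_mul_pow_root hlam hC)
  rw [one_mul] at h2
  refine h2.congr fun n => ?_
  rw [← Real.mul_rpow (by positivity) (by positivity)]
  ring_nf

/-- Bounds `c * lam ^ n ≤ f n ≤ C * (n + 1) * lam ^ n` determine the limit of the roots. -/
lemma tendsto_root_of_bounds {f : ℕ → ℝ} {lam c C : ℝ} (hlam : 0 < lam) (hc : 0 < c)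
    (hC : 0 < C) (hlow : ∀ᶠ n in atTop, c * lam ^ n ≤ f n)
    (hup : ∀ n : ℕ, f n ≤ C * ((n : ℝ) + 1) * lam ^ n) :
    Tendsto (fun n : ℕ => f n ^ ((1 : ℝ) / (n : ℝ))) atTop (𝓝 lam) := by
  refine tendsto_of_tendsto_of_tendsto_of_le_of_le' (tendsto_const_mul_pow_root hlam hc)
    (tendsto_const_mul_succ_mul_pow_root hlam hC) ?_ ?_
  · filter_upwards [hlow] with n hn
    exact Real.rpow_le_rpow (by positivity) hn (by positivity)
  · filter_upwards [hlow] with n hn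
    exact Real.rpow_le_rpow (le_trans (by positivity) hn) (hup n) (by positivity)

namespace EdgeSystem

variable {E : Type*} [Fintype E] {d : ℕ} {S : EdgeSystem E d}

/-- A count that obeys the walk recursion with at most one new walk per edge grows at most like
`n * lam ^ n`; the linear factor absorbs the new walks. -/
lemma IsPerron.exists_count_le {ℓ : E → ℕ} {lam : ℝ} {y : E → ℝ} (h : S.IsPerron ℓ lam y)
    (hlam : 1 ≤ lam) (hℓ : ∀ e, 1 ≤ ℓ e) {N : E → ℕ → ℕ} (hzero : ∀ e n, n < ℓ e → N e n = 0)
    (hN : ∀ e n, ℓ e ≤ n → N e n ≤ 1 + ∑ g ∈ S.pred e, N g (n - ℓ e)) :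
    ∃ C : ℝ, 0 < C ∧ ∀ e n, (N e n : ℝ) ≤ C * (n + 1) * lam ^ n := by
  rcases isEmpty_or_nonempty E with hE | hE
  · exact ⟨1, one_pos, fun e => hE.elim e⟩
  have hlam0 : 0 < lam := by linarith
  obtain ⟨e₀, -, he₀⟩ := Finset.exists_min_image Finset.univ y Finset.univ_nonempty
  obtain ⟨e₁, -, he₁⟩ := Finset.exists_max_image Finset.univ y Finset.univ_nonempty
  have key : ∀ n e, (N e n : ℝ) ≤ (y e₀)⁻¹ * (n + 1) * lam ^ n * y e := by
    intro n
    induction n using Nat.strong_induction_on with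
    | _ n ih =>
    intro e
    have h0 := h.pos e₀
    have h0' := h.pos e
    rcases lt_or_ge n (ℓ e) with hn | hn
    · rw [hzero e n hn, Nat.cast_zero]
      positivity
    obtain ⟨k, rfl⟩ := Nat.exists_eq_add_of_le hn
    have hℓe := hℓ e
    have h1 : (N e (ℓ e + k) : ℝ) ≤ 1 + ∑ g ∈ S.pred e, (N g k : ℝ) := by
      have := hN e _ hn
      rw [Nat.add_sub_cancel_left] at this
      exact_mod_cast this
    have h2 : ∑ g ∈ S.pred e, (N g k : ℝ) ≤
        (y e₀)⁻¹ * (k + 1) * lam ^ k * (lam ^ ℓ e * y e) := by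
      rw [h.eq, Finset.mul_sum]
      exact Finset.sum_le_sum fun g _ => ih k (by omega) g
    have h3 : 1 ≤ (y e₀)⁻¹ * lam ^ (ℓ e + k) * y e := by
      have h4 : 1 ≤ (y e₀)⁻¹ * y e := by
        rw [le_inv_mul_iff₀ h0, mul_one]; exact he₀ e (Finset.mem_univ _)
      have h5 : 1 ≤ lam ^ (ℓ e + k) := one_le_pow₀ hlam
      nlinarith
    have h6 : (0 : ℝ) ≤ (ℓ e - 1) * ((y e₀)⁻¹ * lam ^ (ℓ e + k) * y e) := by
      have : (1 : ℝ) ≤ ℓ e := by exact_mod_cast hℓe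
      have : (0 : ℝ) ≤ ℓ e - 1 := by linarith
      positivity
    rw [pow_add] at h3 h6 ⊢
    push_cast
    linarith
  refine ⟨(y e₀)⁻¹ * y e₁, mul_pos (inv_pos.2 (h.pos _)) (h.pos _), fun e n => ?_⟩
  refine (key n e).trans ?_
  have h0 := h.pos e₀
  have := he₁ e (Finset.mem_univ _)
  calc (y e₀)⁻¹ * (n + 1) * lam ^ n * y e ≤ (y e₀)⁻¹ * (n + 1) * lam ^ n * y e₁ := by gcongr
    _ = _ := by ring

/-- A count that obeys the walk recursion and starts from some edge grows at least like `lam ^ n`: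
by irreducibility it is eventually positive at every edge, and then it dominates a multiple of the
Perron eigenvector. -/
lemma IsPerron.exists_le_count {ℓ : E → ℕ} {lam : ℝ} {y : E → ℝ} (h : S.IsPerron ℓ lam y)
    (hlam : 1 ≤ lam) (hℓ : ∀ e, 1 ≤ ℓ e) (hS : S.Irreducible) {N : E → ℕ → ℕ}
    (hN : ∀ e n, ℓ e ≤ n → ∑ g ∈ S.pred e, N g (n - ℓ e) ≤ N e n)
    {e₀ : E} (he₀ : ∀ n, ℓ e₀ ≤ n → 1 ≤ N e₀ n) (e : E) :
    ∃ c : ℝ, 0 < c ∧ ∀ᶠ n in atTop, c * lam ^ n ≤ (N e n : ℝ) := by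
  have hlam0 : 0 < lam := by linarith
  have hstep : ∀ a b, S.Follows a b → (∀ᶠ n in atTop, 1 ≤ N a n) → ∀ᶠ n in atTop, 1 ≤ N b n := by
    intro a b hab ha
    filter_upwards [(tendsto_sub_atTop_nat (ℓ b)).eventually ha, eventually_ge_atTop (ℓ b)]
      with n hn hn'
    refine hn.trans (le_trans ?_ (hN b n hn'))
    exact Finset.single_le_sum (f := fun g => N g (n - ℓ b)) (fun _ _ => Nat.zero_le _)
      (S.mem_pred.2 hab)
  have hpos : ∀ᶠ n in atTop, ∀ e, 1 ≤ N e n := by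
    refine eventually_all.2 fun e => ?_
    have h0 : ∀ᶠ n in atTop, 1 ≤ N e₀ n := eventually_atTop.2 ⟨_, he₀⟩
    have h1 := hS e₀ e
    induction h1 with
    | single hab => exact hstep _ _ hab h0
    | tail _ hab ih => exact hstep _ _ hab ih
  obtain ⟨n₀, hn₀⟩ := eventually_atTop.1 hpos
  obtain ⟨e₁, -, he₁⟩ := Finset.exists_max_image Finset.univ y ⟨e, Finset.mem_univ _⟩
  obtain ⟨e₂, -, he₂⟩ := Finset.exists_max_image Finset.univ ℓ ⟨e, Finset.mem_univ _⟩
  -- The constant makes the bound trivial for the first `ℓ e₂` values of `n` after `n₀`.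
  set c := (lam ^ (n₀ + ℓ e₂) * y e₁)⁻¹ with hc
  have hcpos : 0 < c := inv_pos.2 (mul_pos (pow_pos hlam0 _) (h.pos _))
  have key : ∀ n, n₀ ≤ n → ∀ e, c * lam ^ n * y e ≤ N e n := by
    intro n
    induction n using Nat.strong_induction_on with
    | _ n ih =>
    intro hn e
    rcases le_or_gt n (n₀ + ℓ e₂) with hle | hlt
    · refine le_trans ?_ (Nat.one_le_cast.2 (hn₀ n hn e))
      rw [hc, mul_assoc, inv_mul_le_iff₀ (mul_pos (pow_pos hlam0 _) (h.pos _)), mul_one]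
      exact mul_le_mul (pow_le_pow_right₀ hlam hle) (he₁ e (Finset.mem_univ _)) (h.pos e).le
        (pow_pos hlam0 _).le
    · have hℓ2 := he₂ e (Finset.mem_univ _)
      have hz := hℓ e
      obtain ⟨k, rfl⟩ := Nat.exists_eq_add_of_le (show ℓ e ≤ n by omega)
      have h1 := hN e (ℓ e + k) (by omega)
      rw [Nat.add_sub_cancel_left] at h1
      calc c * lam ^ (ℓ e + k) * y e = ∑ g ∈ S.pred e, c * lam ^ k * y g := by
            rw [← Finset.mul_sum, ← h.eq]; ring
        _ ≤ ∑ g ∈ S.pred e, (N g k : ℝ) :=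
            Finset.sum_le_sum fun g _ => ih k (by omega) (by omega) g
        _ ≤ _ := by exact_mod_cast h1
  refine ⟨c * y e, mul_pos hcpos (h.pos e), eventually_atTop.2 ⟨n₀, fun n hn => ?_⟩⟩
  rw [mul_right_comm]
  exact key n hn e

end EdgeSystem

/-! ### Reduced words as nonbacktracking walks in a finite Cayley graph -/

section Cayley

variable {α : Type*} {Q : Type*} [Group Q]

/-- The formal inverse of a letter. -/
def invLetter (s : α × Bool) : α × Bool := (s.1, !s.2)

@[simp]
lemma invLetter_invLetter (s : α × Bool) : invLetter (invLetter s) = s := by simp [invLetter]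

lemma ne_invLetter_iff {s t : α × Bool} : t ≠ invLetter s ↔ (s.1 = t.1 → s.2 = t.2) := by
  rcases s with ⟨a, b⟩
  rcases t with ⟨a', b'⟩
  simp only [invLetter, ne_eq, Prod.mk.injEq, not_and, eq_comm (a := a)]
  cases b <;> cases b' <;> simp

lemma mk_invLetter (s : α × Bool) :
    FreeGroup.mk [invLetter s] = (FreeGroup.mk [s])⁻¹ := by
  simp [FreeGroup.inv_mk, FreeGroup.invRev, invLetter]

lemma mk_cons (s : α × Bool) (l : List (α × Bool)) :
    FreeGroup.mk (s :: l) = FreeGroup.mk [s] * FreeGroup.mk l := by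
  rw [FreeGroup.mul_mk, List.singleton_append]

lemma letter_induction {p : FreeGroup α → Prop} (one : p 1)
    (mul : ∀ (s : α × Bool) w, p w → p (FreeGroup.mk [s] * w)) (w : FreeGroup α) : p w := by
  induction w using Quot.inductionOn with
  | _ l =>
  induction l with
  | nil => exact one
  | cons s l ih =>
    have := mul s _ ih
    rwa [FreeGroup.quot_mk_eq_mk, ← mk_cons] at this

/-- The total length of the walk from `1` spelled by a word. -/
def walkLength (π : FreeGroup α →* Q) (ℓ : Q × (α × Bool) → ℕ) : List (α × Bool) → ℕ
  | [] => 0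
  | s :: l => ℓ (π (FreeGroup.mk l), s) + walkLength π ℓ l

variable {π : FreeGroup α →* Q} {ℓ : Q × (α × Bool) → ℕ}

lemma length_le_walkLength (hℓ : ∀ e, 1 ≤ ℓ e) (l : List (α × Bool)) :
    l.length ≤ walkLength π ℓ l := by
  induction l with
  | nil => simp
  | cons s l ih =>
    have := hℓ (π (FreeGroup.mk l), s)
    simp only [List.length_cons, walkLength]
    omega

variable (π ℓ) in
/-- The words `l` for which `e.2 :: l` spells a nonbacktracking walk from `1` of length at most `n`
whose last edge is `e`. -/
def walkSet (e : Q × (α × Bool)) (n : ℕ) : Set (List (α × Bool)) :=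
  {l | FreeGroup.IsReduced (e.2 :: l) ∧ π (FreeGroup.mk l) = e.1 ∧ walkLength π ℓ l + ℓ e ≤ n}

variable (π ℓ) in
/-- The reduced words that spell closed walks at `1` of length at most `n`. -/
def closedWalkSet (n : ℕ) : Set (List (α × Bool)) :=
  {l | FreeGroup.IsReduced l ∧ π (FreeGroup.mk l) = 1 ∧ walkLength π ℓ l ≤ n}

lemma ncard_walkSet_eq_zero {e : Q × (α × Bool)} {n : ℕ} (h : n < ℓ e) :
    (walkSet π ℓ e n).ncard = 0 := by
  have : walkSet π ℓ e n = ∅ := by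
    refine Set.eq_empty_of_forall_notMem fun l hl => ?_
    have := hl.2.2
    omega
  rw [this, Set.ncard_empty]

lemma ncard_cons_image (s : α × Bool) (A : Set (List (α × Bool))) :
    ((s :: ·) '' A).ncard = A.ncard :=
  Set.ncard_image_of_injective _ List.cons_injective

variable [Fintype α]

lemma finite_walkSet (hℓ : ∀ e, 1 ≤ ℓ e) (e : Q × (α × Bool)) (n : ℕ) :
    (walkSet π ℓ e n).Finite :=
  (List.finite_length_le (α × Bool) n).subset fun l hl =>
    (length_le_walkLength hℓ l).trans ((Nat.le_add_right _ _).trans hl.2.2)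

lemma finite_closedWalkSet (hℓ : ∀ e, 1 ≤ ℓ e) (n : ℕ) : (closedWalkSet π ℓ n).Finite :=
  (List.finite_length_le (α × Bool) n).subset fun l hl =>
    (length_le_walkLength hℓ l).trans hl.2.2

lemma ncard_walkSet_le_closed (hℓ : ∀ e, 1 ≤ ℓ e) {e : Q × (α × Bool)}
    (he : π (FreeGroup.mk [e.2]) * e.1 = 1) (n : ℕ) :
    (walkSet π ℓ e n).ncard ≤ (closedWalkSet π ℓ n).ncard := by
  rw [← ncard_cons_image e.2]
  refine Set.ncard_le_ncard ?_ (finite_closedWalkSet hℓ n)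
  rintro _ ⟨l, ⟨h1, h2, h3⟩, rfl⟩
  refine ⟨h1, by rw [mk_cons, map_mul, h2, he], ?_⟩
  rw [walkLength, h2]
  exact (Nat.add_comm _ _).trans_le h3

variable [Fintype Q]

/-- The directed edges of the Cayley graph of a finite quotient `π` of the free group: `(q, s)` is
the edge from `q` to `π s * q`. A word is read from right to left as a walk that starts at `1`. -/
def cayleyEdges (π : FreeGroup α →* Q) :
    EdgeSystem (Q × (α × Bool)) (2 * Fintype.card α - 1) where
  Follows g e := e.1 = π (FreeGroup.mk [g.2]) * g.1 ∧ (e.2.1 = g.2.1 → e.2.2 = g.2.2)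
  rev e := (π (FreeGroup.mk [e.2]) * e.1, invLetter e.2)
  rev_rev e := by
    rw [mk_invLetter, map_inv, inv_mul_cancel_left, invLetter_invLetter]
  follows_rev {g e} := by
    rintro ⟨h1, h2⟩
    refine ⟨by rw [mk_invLetter, map_inv, inv_mul_cancel_left, h1], fun h => ?_⟩
    have := h2 h.symm
    simp [invLetter, this]
  card_pred e := by
    classical
    have h1 : {g : Q × (α × Bool) // e.1 = π (FreeGroup.mk [g.2]) * g.1 ∧
        (e.2.1 = g.2.1 → e.2.2 = g.2.2)} ≃ {t : α × Bool // t ≠ invLetter e.2} :=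
      { toFun := fun g => ⟨g.1.2, ne_invLetter_iff.2 g.2.2⟩
        invFun := fun t => ⟨((π (FreeGroup.mk [t.1]))⁻¹ * e.1, t.1),
          by simp, ne_invLetter_iff.1 t.2⟩
        left_inv := fun g => by ext <;> simp [g.2.1]
        right_inv := fun t => rfl }
    rw [Nat.card_congr h1, Nat.card_eq_fintype_card, Fintype.card_subtype_compl]
    simp [mul_comm]

lemma cayleyEdges_rev {π : FreeGroup α →* Q} (q : Q) (s : α × Bool) :
    (cayleyEdges π).rev (q, s) = (π (FreeGroup.mk [s]) * q, invLetter s) := rfl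

/-- With at least two generators, a nonbacktracking walk can turn around: going once around the
orbit of a letter, it returns to where it was and may leave by a different edge. -/
lemma cayleyEdges_irreducible [Nontrivial α] {π : FreeGroup α →* Q}
    (hπ : Function.Surjective π) : (cayleyEdges π).Irreducible := by
  classical
  set R := (cayleyEdges π).Follows with hR
  have hpow : ∀ q s (n : ℕ), Relation.TransGen R (q, s)
      (π (FreeGroup.mk [s]) ^ (n + 1) * q, s) := fun q s n => by
    induction n with
    | zero => exact .single ⟨by simp, fun _ => rfl⟩
    | succ n ih => exact ih.tail ⟨by simp [pow_succ', mul_assoc], fun _ => rfl⟩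
  have hturn : ∀ q s t, t ≠ invLetter s → Relation.TransGen R (q, s) (q, t) := by
    intro q s t hst
    obtain ⟨n, hn0, hn⟩ := (isOfFinOrder_of_finite (π (FreeGroup.mk [s]))).exists_pow_eq_one
    -- After `2 * n - 1` steps the walk is one step before `q`.
    refine (hpow q s (2 * n - 2)).tail ⟨?_, ?_⟩
    · have : (2 * n - 2 + 1) + 1 = n * 2 := by omega
      simp only
      rw [← mul_assoc, ← pow_succ', this, pow_mul, hn, one_pow, one_mul]
    · exact fun h => (ne_invLetter_iff.1 hst h.symm).symm
  have hall : ∀ q s t, Relation.TransGen R (q, s) (q, t) := by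
    intro q s t
    by_cases hst : t = invLetter s
    · obtain ⟨b, hb⟩ := exists_ne s.1
      refine (hturn q s (b, true) ?_).trans (hturn q (b, true) t ?_)
      · exact fun h => hb (congrArg Prod.fst h)
      · rw [hst]
        exact fun h => hb (congrArg Prod.fst h).symm
    · exact hturn q s t hst
  have hmove : ∀ (w : FreeGroup α) q s t, Relation.TransGen R (q, s) (π w * q, t) := by
    intro w
    induction w using letter_induction with
    | one => intro q s t; simpa using hall q s t
    | mul u w ih =>
      intro q s t
      refine ((ih q s u).trans (hpow _ u 0)).trans ?_
      rw [map_mul, zero_add, pow_one, mul_assoc]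
      exact hall _ _ _
  rintro ⟨q, s⟩ ⟨q', t⟩
  obtain ⟨w, hw⟩ := hπ (q' * q⁻¹)
  simpa [hw] using hmove w q s t

/-- A backward nonbacktracking walk spells a reduced word that connects its vertices. -/
lemma exists_reduced_of_isChain {π : FreeGroup α →* Q} (l : List (Q × (α × Bool)))
    (e : Q × (α × Bool)) (hl : (e :: l).IsChain fun a b => (cayleyEdges π).Follows b a)
    {f : Q × (α × Bool)} (hf : f ∈ l) :
    ∃ m, FreeGroup.IsReduced (e.2 :: m) ∧ m ≠ [] ∧ m.length ≤ l.length ∧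
      π (FreeGroup.mk m) * f.1 = e.1 := by
  induction l generalizing e with
  | nil => simp at hf
  | cons g l ih =>
    obtain ⟨⟨h1, h2⟩, h3⟩ := List.isChain_cons_cons.1 hl
    rcases List.mem_cons.1 hf with rfl | hf
    · refine ⟨[f.2], ?_, by simp, by simp, h1.symm⟩
      exact FreeGroup.isReduced_cons_cons.2 ⟨h2, FreeGroup.IsReduced.singleton⟩
    · obtain ⟨m, hm1, -, hm2, hm3⟩ := ih g h3 hf
      refine ⟨g.2 :: m, FreeGroup.isReduced_cons_cons.2 ⟨h2, hm1⟩, by simp, by simpa using hm2, ?_⟩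
      rw [mk_cons, map_mul, mul_assoc, hm3, h1]

/-- If the kernel of `π` contains no short elements, then the Cayley graph has large girth: short
nonbacktracking walks do not repeat edges. -/
lemma nodup_of_isChain [DecidableEq α] {π : FreeGroup α →* Q} {G : ℕ}
    (hG : ∀ w, FreeGroup.norm w ≤ G → π w = 1 → w = 1) (l : List (Q × (α × Bool)))
    (hl : l.IsChain fun a b => (cayleyEdges π).Follows b a) (hlen : l.length ≤ G) : l.Nodup := by
  induction l with
  | nil => exact List.nodup_nil
  | cons e l ih =>
    rw [List.length_cons] at hlen
    refine List.nodup_cons.2 ⟨fun he => ?_, ih hl.tail (by omega)⟩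
    obtain ⟨m, hm1, hm0, hm2, hm3⟩ := exists_reduced_of_isChain l e hl he
    have h1 : FreeGroup.mk m = 1 :=
      hG _ (FreeGroup.norm_mk_le.trans (by omega)) (mul_eq_right.1 hm3)
    have hm : FreeGroup.IsReduced m := hm1.tail
    rw [← FreeGroup.toWord_eq_nil_iff, FreeGroup.toWord_mk, hm.reduce_eq] at h1
    exact hm0 h1

lemma cons_image_walkSet_subset {e g : Q × (α × Bool)} (hg : (cayleyEdges π).Follows g e) {n : ℕ}
    (h : ℓ e ≤ n) : (g.2 :: ·) '' walkSet π ℓ g (n - ℓ e) ⊆ walkSet π ℓ e n := by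
  rintro _ ⟨l, ⟨h1, h2, h3⟩, rfl⟩
  refine ⟨FreeGroup.isReduced_cons_cons.2 ⟨hg.2, h1⟩, ?_, ?_⟩
  · rw [mk_cons, map_mul, h2, hg.1]
  · rw [walkLength, h2]
    simp only [Prod.mk.eta]
    omega

/-- A walk that ends with `e` is `e` alone or extends a walk that ends with a predecessor of `e`. -/
lemma ncard_walkSet_le (hℓ : ∀ e, 1 ≤ ℓ e) (e : Q × (α × Bool)) (n : ℕ) :
    (walkSet π ℓ e n).ncard ≤
      1 + ∑ g ∈ (cayleyEdges π).pred e, (walkSet π ℓ g (n - ℓ e)).ncard := by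
  have hsub : walkSet π ℓ e n ⊆
      {[]} ∪ ⋃ g ∈ (cayleyEdges π).pred e, (g.2 :: ·) '' walkSet π ℓ g (n - ℓ e) := by
    rintro l ⟨h1, h2, h3⟩
    rcases l with _ | ⟨t, l⟩
    · exact Or.inl rfl
    · refine Or.inr (Set.mem_iUnion₂.2 ⟨(π (FreeGroup.mk l), t), ?_, l, ⟨?_, rfl, ?_⟩, rfl⟩)
      · rw [EdgeSystem.mem_pred]
        refine ⟨?_, (FreeGroup.isReduced_cons_cons.1 h1).1⟩
        rw [← h2, mk_cons, map_mul]
      · exact (FreeGroup.isReduced_cons_cons.1 h1).2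
      · rw [walkLength] at h3
        omega
  have hfin : ∀ g, ((g.2 :: ·) '' walkSet π ℓ g (n - ℓ e)).Finite :=
    fun g => (finite_walkSet hℓ g _).image _
  refine (Set.ncard_le_ncard hsub ((Set.finite_singleton _).union
    ((Finset.finite_toSet _).biUnion fun g _ => hfin g))).trans ?_
  refine (Set.ncard_union_le _ _).trans ?_
  rw [Set.ncard_singleton]
  refine Nat.add_le_add_left ((Finset.set_ncard_biUnion_le _ _).trans ?_) _
  exact Finset.sum_le_sum fun g _ => (ncard_cons_image _ _).le

/-- Walks with different last edges but one are different, so the recursion for the number of walks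
also bounds it from below. -/
lemma sum_ncard_walkSet_le (hℓ : ∀ e, 1 ≤ ℓ e) {e : Q × (α × Bool)} {n : ℕ} (h : ℓ e ≤ n) :
    ∑ g ∈ (cayleyEdges π).pred e, (walkSet π ℓ g (n - ℓ e)).ncard ≤
      (walkSet π ℓ e n).ncard := by
  have hfin : ∀ g, ((g.2 :: ·) '' walkSet π ℓ g (n - ℓ e)).Finite :=
    fun g => (finite_walkSet hℓ g _).image _
  have hsub : ⋃ g ∈ ((cayleyEdges π).pred e : Set (Q × (α × Bool))),
      (g.2 :: ·) '' walkSet π ℓ g (n - ℓ e) ⊆ walkSet π ℓ e n :=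
    Set.iUnion₂_subset fun g hg =>
      cons_image_walkSet_subset ((cayleyEdges π).mem_pred.1 (Finset.mem_coe.1 hg)) h
  refine le_trans (le_of_eq ?_) (Set.ncard_le_ncard hsub (finite_walkSet hℓ e n))
  rw [Set.Finite.ncard_biUnion (Finset.finite_toSet _) (fun g _ => hfin g),
    finsum_mem_coe_finset]
  · exact Finset.sum_congr rfl fun g _ => (ncard_cons_image _ _).symm
  · rintro g - g' - hne
    refine Set.disjoint_left.2 ?_
    rintro _ ⟨l, hl, rfl⟩ ⟨l', hl', heq⟩
    obtain ⟨h1, rfl⟩ := List.cons.inj heq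
    exact hne (Prod.ext (hl.2.1.symm.trans hl'.2.1) h1.symm)

lemma ncard_closedWalkSet_le (hℓ : ∀ e, 1 ≤ ℓ e) (n : ℕ) :
    (closedWalkSet π ℓ n).ncard ≤ 1 + ∑ e, (walkSet π ℓ e n).ncard := by
  have hsub : closedWalkSet π ℓ n ⊆
      {[]} ∪ ⋃ e ∈ (Finset.univ : Finset (Q × (α × Bool))), (e.2 :: ·) '' walkSet π ℓ e n := by
    rintro l ⟨h1, h2, h3⟩
    rcases l with _ | ⟨t, l⟩
    · exact Or.inl rfl
    · refine Or.inr (Set.mem_iUnion₂.2 ⟨(π (FreeGroup.mk l), t), Finset.mem_univ _, l,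
        ⟨h1, rfl, ?_⟩, rfl⟩)
      rw [walkLength] at h3
      omega
  have hfin : ∀ e, ((e.2 :: ·) '' walkSet π ℓ e n).Finite :=
    fun e => (finite_walkSet hℓ e _).image _
  refine (Set.ncard_le_ncard hsub ((Set.finite_singleton _).union
    ((Finset.finite_toSet _).biUnion fun e _ => hfin e))).trans ?_
  refine (Set.ncard_union_le _ _).trans ?_
  rw [Set.ncard_singleton]
  refine Nat.add_le_add_left ((Finset.set_ncard_biUnion_le _ _).trans ?_) _
  exact Finset.sum_le_sum fun g _ => (ncard_cons_image _ _).le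

lemma exists_ncard_closedWalkSet_le {lam : ℝ} {y : Q × (α × Bool) → ℝ}
    (h : (cayleyEdges π).IsPerron ℓ lam y) (hlam : 1 ≤ lam) (hℓ : ∀ e, 1 ≤ ℓ e) :
    ∃ C : ℝ, 0 < C ∧ ∀ n, ((closedWalkSet π ℓ n).ncard : ℝ) ≤ C * ((n : ℝ) + 1) * lam ^ n := by
  obtain ⟨C, hC, hle⟩ := h.exists_count_le hlam hℓ (N := fun e n => (walkSet π ℓ e n).ncard)
    (fun e n hn => ncard_walkSet_eq_zero hn) (fun e n _ => ncard_walkSet_le hℓ e n)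
  refine ⟨1 + Fintype.card (Q × (α × Bool)) * C, by positivity, fun n => ?_⟩
  have h1 : ((closedWalkSet π ℓ n).ncard : ℝ) ≤
      1 + ∑ e : Q × (α × Bool), ((walkSet π ℓ e n).ncard : ℝ) := by
    exact_mod_cast ncard_closedWalkSet_le hℓ n
  have h2 : ∑ e : Q × (α × Bool), ((walkSet π ℓ e n).ncard : ℝ) ≤
      Fintype.card (Q × (α × Bool)) * (C * (n + 1) * lam ^ n) := by
    refine (Finset.sum_le_sum fun e _ => hle e n).trans_eq ?_
    rw [Finset.sum_const, nsmul_eq_mul, Finset.card_univ]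
  have h3 : 1 ≤ ((n : ℝ) + 1) * lam ^ n := by
    have h4 : 1 ≤ lam ^ n := one_le_pow₀ hlam
    have h5 : (1 : ℝ) ≤ (n : ℝ) + 1 := by simp
    nlinarith
  nlinarith

/-- The exponential growth rate of the closed walks is the Perron eigenvalue. -/
theorem tendsto_ncard_closedWalkSet [Nontrivial α] (hπ : Function.Surjective π) {lam : ℝ}
    {y : Q × (α × Bool) → ℝ} (h : (cayleyEdges π).IsPerron ℓ lam y) (hlam : 1 ≤ lam)
    (hℓ : ∀ e, 1 ≤ ℓ e) :
    Tendsto (fun n : ℕ => ((closedWalkSet π ℓ n).ncard : ℝ) ^ ((1 : ℝ) / (n : ℝ))) atTop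
      (𝓝 lam) := by
  obtain ⟨C, hC, hup⟩ := exists_ncard_closedWalkSet_le h hlam hℓ
  obtain ⟨a⟩ : Nonempty α := inferInstance
  obtain ⟨c, hc, hlow⟩ := h.exists_le_count hlam hℓ (cayleyEdges_irreducible hπ)
    (N := fun e n => (walkSet π ℓ e n).ncard) (fun e n hn => sum_ncard_walkSet_le hℓ hn)
    (e₀ := (1, (a, true))) (fun n hn => by
      refine (Set.ncard_pos (finite_walkSet hℓ _ n)).2 ⟨[], FreeGroup.IsReduced.singleton, ?_, ?_⟩
      · exact map_one π
      · simpa [walkLength] using hn) ((π (FreeGroup.mk [(a, true)]))⁻¹, (a, true))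
  refine tendsto_root_of_bounds (by linarith) hc hC (hlow.mono fun n hn => hn.trans ?_) hup
  exact_mod_cast ncard_walkSet_le_closed hℓ (mul_inv_cancel _) n

end Cayley

/-! ### Finite quotients of a free group without short elements in the kernel -/

lemma finite_norm_le {α : Type*} [Finite α] [DecidableEq α] (n : ℕ) :
    {w : FreeGroup α | FreeGroup.norm w ≤ n}.Finite :=
  (List.finite_length_le (α × Bool) n).preimage FreeGroup.toWord_injective.injOn

/-- Residual finiteness of free groups, for all elements of a ball at once: left multiplication by
a generator is a partial injection of the ball, and any extension to permutations of the ball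
gives an action in which `w` maps `1` to `w`. -/
theorem exists_finite_quotient.{u} {α : Type u} [Finite α] [DecidableEq α] (G : ℕ) :
    ∃ (X : Type u) (_ : Fintype X) (π : FreeGroup α →* Equiv.Perm X),
      ∀ w, FreeGroup.norm w ≤ G → π w = 1 → w = 1 := by
  classical
  set t : Finset (FreeGroup α) := (finite_norm_le G).toFinset with ht
  have hmem : ∀ w, w ∈ t ↔ FreeGroup.norm w ≤ G := fun w => by simp [ht]
  have hext : ∀ a : α, ∃ g : t ≃ t, ∀ w : t, FreeGroup.of a * w.1 ∈ t →
      (g w : FreeGroup α) = FreeGroup.of a * w.1 := fun a =>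
    Set.MapsTo.exists_equiv_extend_of_card_eq (α := t) (Fintype.card_coe t)
      (s := {w | FreeGroup.of a * w.1 ∈ t}) (f := fun w => FreeGroup.of a * w.1)
      (fun w hw => hw) (fun w _ w' _ h => Subtype.ext (mul_left_cancel h))
  choose g hg using hext
  refine ⟨t, inferInstance, FreeGroup.lift g, fun w hw hw1 => ?_⟩
  have h1 : (1 : FreeGroup α) ∈ t := by simp [hmem]
  have key : ∀ l : List (α × Bool), l.length ≤ G →
      (FreeGroup.lift g (FreeGroup.mk l) ⟨1, h1⟩ : FreeGroup α) = FreeGroup.mk l := by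
    intro l hl
    have hlt : ∀ l : List (α × Bool), l.length ≤ G → FreeGroup.mk l ∈ t := fun l hl =>
      (hmem _).2 (FreeGroup.norm_mk_le.trans hl)
    induction l with
    | nil => simp [← FreeGroup.one_eq_mk]
    | cons s l ih =>
      have hl' : l.length ≤ G := by rw [List.length_cons] at hl; omega
      have hx : FreeGroup.lift g (FreeGroup.mk l) ⟨1, h1⟩ = ⟨FreeGroup.mk l, hlt l hl'⟩ :=
        Subtype.ext (ih hl')
      rw [mk_cons, map_mul, Equiv.Perm.mul_apply, hx]
      rcases s with ⟨a, _ | _⟩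
      · have hinv : FreeGroup.mk [(a, false)] = (FreeGroup.of a)⁻¹ := mk_invLetter (a, true)
        have hs := hlt _ hl
        rw [mk_cons, hinv] at hs
        have h2 : g a ⟨(FreeGroup.of a)⁻¹ * FreeGroup.mk l, hs⟩ =
            ⟨FreeGroup.mk l, hlt l hl'⟩ := Subtype.ext <| by
          rw [hg a _ (by simpa using hlt l hl')]; simp
        rw [hinv, map_inv, FreeGroup.lift_apply_of, ← h2, Equiv.Perm.inv_def,
          Equiv.symm_apply_apply]
      · have hs := hlt _ hl
        rw [mk_cons] at hs
        exact (congrArg _ (congrFun (congrArg _ FreeGroup.lift_apply_of) _)).trans (hg a _ hs)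
  have := key w.toWord hw
  rw [FreeGroup.mk_toWord, hw1] at this
  simpa using this.symm

/-! ### The subgroup spelled by the closed walks -/

section Spell

variable {α : Type*} {Q : Type*} [Group Q] (π : FreeGroup α →* Q) (ℓ : Q × (α × Bool) → ℕ)

/-- The label of the walk from `1` spelled by a word, when the edge `(q, s)` is subdivided into
`ℓ (q, s)` edges that all carry the letter `s`. -/
def spell : List (α × Bool) → List (α × Bool)
  | [] => []
  | s :: l => List.replicate (ℓ (π (FreeGroup.mk l), s)) s ++ spell l

lemma length_spell (l : List (α × Bool)) : (spell π ℓ l).length = walkLength π ℓ l := by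
  induction l with
  | nil => rfl
  | cons s l ih => simp [spell, walkLength, ih]

variable {π ℓ}

lemma head?_spell (hℓ : ∀ e, 1 ≤ ℓ e) (l : List (α × Bool)) :
    (spell π ℓ l).head? = l.head? := by
  cases l with
  | nil => rfl
  | cons s l =>
    have := hℓ (π (FreeGroup.mk l), s)
    obtain ⟨k, hk⟩ := Nat.exists_eq_add_of_le' this
    simp [spell, hk, List.replicate_succ]

lemma isReduced_spell (hℓ : ∀ e, 1 ≤ ℓ e) {l : List (α × Bool)} (hl : FreeGroup.IsReduced l) :
    FreeGroup.IsReduced (spell π ℓ l) := by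
  induction l with
  | nil => exact hl
  | cons s l ih =>
    refine List.IsChain.append (List.isChain_replicate_of_rel _ fun _ => rfl)
      (ih (List.IsChain.tail hl)) fun x hx y hy => ?_
    rw [head?_spell hℓ] at hy
    have hxs : x = s := List.eq_of_mem_replicate (List.mem_of_getLast? hx)
    rw [hxs]
    exact List.IsChain.rel_head? hl hy

variable (π ℓ) in
/-- The action of the free group on pairs (vertex, label) that follows subdivided edges and
multiplies their labels. It makes the label of a walk invariant under free reduction. -/
def labelAction : FreeGroup α →* Equiv.Perm (Q × FreeGroup α) :=
  FreeGroup.lift fun a =>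
    { toFun := fun p => (π (FreeGroup.of a) * p.1,
        FreeGroup.of a ^ ℓ (p.1, (a, true)) * p.2)
      invFun := fun p => ((π (FreeGroup.of a))⁻¹ * p.1,
        (FreeGroup.of a ^ ℓ ((π (FreeGroup.of a))⁻¹ * p.1, (a, true)))⁻¹ * p.2)
      left_inv := fun p => by simp
      right_inv := fun p => by simp }

lemma mk_replicate (s : α × Bool) (n : ℕ) :
    FreeGroup.mk (List.replicate n s) = FreeGroup.mk [s] ^ n := by
  induction n with
  | zero => rfl
  | succ n ih => rw [List.replicate_succ, mk_cons, ih, pow_succ']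

lemma labelAction_mk [Fintype α] [Fintype Q] (hrev : ∀ e, ℓ ((cayleyEdges π).rev e) = ℓ e)
    (l : List (α × Bool)) (g : FreeGroup α) :
    labelAction π ℓ (FreeGroup.mk l) (1, g) =
      (π (FreeGroup.mk l), FreeGroup.mk (spell π ℓ l) * g) := by
  induction l with
  | nil => simp [← FreeGroup.one_eq_mk, spell]
  | cons s l ih =>
    rw [mk_cons, map_mul, Equiv.Perm.mul_apply, ih, spell, ← FreeGroup.mul_mk, mk_replicate,
      map_mul, mul_assoc]
    rcases s with ⟨a, _ | _⟩
    · have hinv : FreeGroup.mk [(a, false)] = (FreeGroup.of a)⁻¹ := mk_invLetter (a, true)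
      have h1 := hrev (π (FreeGroup.mk l), (a, false))
      rw [cayleyEdges_rev, hinv, map_inv] at h1
      rw [hinv, map_inv, map_inv, labelAction, FreeGroup.lift_apply_of, ← h1, inv_pow]
      rfl
    · have h2 : FreeGroup.mk [(a, true)] = FreeGroup.of a := rfl
      rw [h2, labelAction, FreeGroup.lift_apply_of]
      rfl

/-- The homomorphism that sends a closed walk to its label. -/
def spellHom [DecidableEq α] [Fintype α] [Fintype Q]
    (hrev : ∀ e, ℓ ((cayleyEdges π).rev e) = ℓ e) : π.ker →* FreeGroup α :=
  MonoidHom.mk' (fun k => FreeGroup.mk (spell π ℓ k.1.toWord)) fun k k' => by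
    have h : ∀ (k : π.ker) (g : FreeGroup α), labelAction π ℓ k.1 (1, g) =
        (1, FreeGroup.mk (spell π ℓ k.1.toWord) * g) := fun k g => by
      have := labelAction_mk hrev k.1.toWord g
      rwa [FreeGroup.mk_toWord, π.mem_ker.1 k.2] at this
    have h1 := h (k * k') 1
    rw [Subgroup.coe_mul, map_mul, Equiv.Perm.mul_apply, h, h] at h1
    simpa using (congrArg Prod.snd h1).symm

variable [DecidableEq α] [Fintype α] [Fintype Q] (hrev : ∀ e, ℓ ((cayleyEdges π).rev e) = ℓ e)

lemma norm_spellHom (hℓ : ∀ e, 1 ≤ ℓ e) (k : π.ker) :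
    (spellHom hrev k).norm = walkLength π ℓ k.1.toWord := by
  rw [← length_spell, FreeGroup.norm]
  change (FreeGroup.mk _).toWord.length = _
  rw [FreeGroup.toWord_mk, (isReduced_spell hℓ FreeGroup.isReduced_toWord).reduce_eq]

lemma spellHom_injective (hℓ : ∀ e, 1 ≤ ℓ e) : Function.Injective (spellHom hrev) := by
  refine (injective_iff_map_eq_one _).2 fun k hk => ?_
  have h1 := norm_spellHom hrev hℓ k
  rw [hk, FreeGroup.norm_one] at h1
  have h2 := length_le_walkLength (π := π) hℓ k.1.toWord
  rw [← h1] at h2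
  exact Subtype.ext (FreeGroup.toWord_eq_nil_iff.1 (List.length_eq_zero_iff.1 (by omega)))

/-- The growth of the subgroup of labels is the growth of the closed walks. -/
lemma ncard_range_spellHom (hℓ : ∀ e, 1 ≤ ℓ e) (n : ℕ) :
    {w | w ∈ (spellHom hrev).range ∧ FreeGroup.norm w ≤ n}.ncard =
      (closedWalkSet π ℓ n).ncard := by
  refine (Set.ncard_congr (fun l hl => spellHom hrev ⟨FreeGroup.mk l, hl.2.1⟩) ?_ ?_ ?_).symm
  · intro l hl
    refine ⟨⟨_, rfl⟩, ?_⟩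
    rw [norm_spellHom hrev hℓ]
    simpa [FreeGroup.toWord_mk, hl.1.reduce_eq] using hl.2.2
  · intro l l' hl hl' heq
    have h1 := congrArg (fun k : π.ker => k.1.toWord) (spellHom_injective hrev hℓ heq)
    simpa [FreeGroup.toWord_mk, hl.1.reduce_eq, hl'.1.reduce_eq] using h1
  · rintro _ ⟨⟨k, rfl⟩, hk⟩
    rw [norm_spellHom hrev hℓ] at hk
    refine ⟨k.1.toWord, ⟨FreeGroup.isReduced_toWord, ?_, hk⟩, ?_⟩
    · rw [FreeGroup.mk_toWord]; exact k.2
    · congr 1; exact Subtype.ext FreeGroup.mk_toWord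

lemma fg_map_range_spellHom {F : Type*} [Group F] (f : FreeGroup α →* F) :
    ((spellHom hrev).range.map f).FG := by
  rw [MonoidHom.map_range, ← Group.fg_iff_subgroup_fg]
  infer_instance

end Spell

/-! ### Word length and growth with respect to a free basis -/

section Basis

variable {ι F : Type*} [Group F] [DecidableEq ι] (B : FreeGroupBasis ι F)

lemma wordLength_range_basis (g : F) :
    wordLength (Set.range B) g = FreeGroup.norm (B.repr g) := by
  have hmem : ∀ s : ι × Bool, B.repr.symm (FreeGroup.mk [s]) ∈ Set.range B ∨
      (B.repr.symm (FreeGroup.mk [s]))⁻¹ ∈ Set.range B := by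
    rintro ⟨i, _ | _⟩
    · refine Or.inr ⟨i, ?_⟩
      have hinv : FreeGroup.mk [(i, false)] = (FreeGroup.of i)⁻¹ := mk_invLetter (i, true)
      rw [hinv, map_inv, inv_inv]
      rfl
    · exact Or.inl ⟨i, rfl⟩
  have hprod : ∀ l : List (ι × Bool),
      (l.map fun s => B.repr.symm (FreeGroup.mk [s])).prod = B.repr.symm (FreeGroup.mk l) := by
    intro l
    induction l with
    | nil => simp [← FreeGroup.one_eq_mk]
    | cons s l ih => rw [List.map_cons, List.prod_cons, ih, mk_cons s l, map_mul]
  have hword : FreeGroup.norm (B.repr g) ∈ {n : ℕ | ∃ l : List F, l.length = n ∧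
      (∀ x ∈ l, x ∈ Set.range B ∨ x⁻¹ ∈ Set.range B) ∧ l.prod = g} := by
    refine ⟨(B.repr g).toWord.map fun s => B.repr.symm (FreeGroup.mk [s]), ?_, ?_, ?_⟩
    · rw [List.length_map]; rfl
    · intro x hx
      obtain ⟨s, -, rfl⟩ := List.mem_map.1 hx
      exact hmem s
    · rw [hprod, FreeGroup.mk_toWord, MulEquiv.symm_apply_apply]
  refine le_antisymm (Nat.sInf_le hword) (le_csInf ⟨_, hword⟩ ?_)
  rintro n ⟨l, rfl, hl, rfl⟩
  clear hword
  induction l with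
  | nil => simp
  | cons x l ih =>
    rw [List.prod_cons, map_mul, List.length_cons, add_comm]
    refine (FreeGroup.norm_mul_le _ _).trans (Nat.add_le_add ?_ ?_)
    · rcases hl x (by simp) with ⟨i, rfl⟩ | ⟨i, hi⟩
      · simp
      · rw [← FreeGroup.norm_inv_eq, ← map_inv, ← hi]; simp
    · exact ih fun y hy => hl y (List.mem_cons_of_mem _ hy)

/-- Growth functions may be computed in the standard free group. -/
lemma growthFunction_range_basis (H : Subgroup F) (n : ℕ) :
    growthFunction (Set.range B) H n =
      {w | w ∈ H.map B.repr.toMonoidHom ∧ FreeGroup.norm w ≤ n}.ncard := by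
  rw [growthFunction, ← Set.ncard_image_of_injective _ B.repr.injective]
  congr 1
  ext w
  constructor
  · rintro ⟨g, ⟨hg, hn⟩, rfl⟩
    rw [wordLength_range_basis] at hn
    exact ⟨⟨g, hg, rfl⟩, hn⟩
  · rintro ⟨⟨g, hg, rfl⟩, hn⟩
    refine ⟨g, ⟨hg, ?_⟩, rfl⟩
    rw [wordLength_range_basis]
    exact hn

lemma one_le_growthFunction [Finite ι] (H : Subgroup F) (n : ℕ) :
    1 ≤ growthFunction (Set.range B) H n := by
  rw [growthFunction_range_basis]
  refine (Set.ncard_pos ((finite_norm_le n).subset fun w hw => hw.2)).2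
    ⟨1, one_mem _, ?_⟩
  simp

/-- The upper bound is the growth of the whole group, counted as the growth of the closed walks in
the Cayley graph of the trivial quotient. -/
lemma exists_growthFunction_le [Fintype ι] [Nonempty ι] (H : Subgroup F) :
    ∃ C : ℝ, 0 < C ∧ ∀ n, (growthFunction (Set.range B) H n : ℝ) ≤
      C * ((n : ℝ) + 1) * (2 * (Fintype.card ι : ℝ) - 1) ^ n := by
  have hcard : 1 ≤ Fintype.card ι := Fintype.card_pos
  have hcard' : (1 : ℝ) ≤ Fintype.card ι := by exact_mod_cast hcard
  have hd : ((2 * Fintype.card ι - 1 : ℕ) : ℝ) = 2 * (Fintype.card ι : ℝ) - 1 := by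
    rw [Nat.cast_sub (by omega)]; push_cast; ring
  set π : FreeGroup ι →* Unit := 1 with hπ
  have hperron : (cayleyEdges π).IsPerron (fun _ => 1) (2 * (Fintype.card ι : ℝ) - 1)
      fun _ => 1 := ⟨fun _ => one_pos, fun e => by simp [EdgeSystem.card_pred_eq, hd]⟩
  obtain ⟨C, hC, hle⟩ := exists_ncard_closedWalkSet_le hperron (by linarith) fun _ => le_rfl
  refine ⟨C, hC, fun n => le_trans ?_ (hle n)⟩
  have hlen : ∀ l : List (ι × Bool), walkLength π (fun _ => 1) l = l.length := fun l => by
    induction l with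
    | nil => rfl
    | cons s l ih => rw [walkLength, ih, List.length_cons, add_comm]
  rw [growthFunction_range_basis, Nat.cast_le]
  refine Set.ncard_le_ncard_of_injOn FreeGroup.toWord (fun w hw => ?_)
    FreeGroup.toWord_injective.injOn (finite_closedWalkSet (fun _ => le_rfl) n)
  exact ⟨FreeGroup.isReduced_toWord, rfl, (hlen _).trans_le hw.2⟩

lemma mem_Icc_of_isGrowthRate [Fintype ι] [Nonempty ι] {H : Subgroup F} {b : ℝ}
    (hb : IsGrowthRate (Set.range B) H b) : b ∈ Set.Icc (1 : ℝ) (2 * (Fintype.card ι : ℝ) - 1) := by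
  have hcard' : (1 : ℝ) ≤ Fintype.card ι := by exact_mod_cast Fintype.card_pos (α := ι)
  constructor
  · refine ge_of_tendsto' hb fun n => Real.one_le_rpow ?_ (by positivity)
    exact_mod_cast one_le_growthFunction B H n
  · obtain ⟨C, hC, hle⟩ := exists_growthFunction_le B H
    refine le_of_tendsto_of_tendsto' hb
      (tendsto_const_mul_succ_mul_pow_root (lam := 2 * (Fintype.card ι : ℝ) - 1) (by linarith) hC)
      fun n => ?_
    exact Real.rpow_le_rpow (by positivity) (hle n) (by positivity)

lemma isGrowthRate_bot [Finite ι] : IsGrowthRate (Set.range B) (⊥ : Subgroup F) 1 := by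
  have h : ∀ n, growthFunction (Set.range B) (⊥ : Subgroup F) n = 1 := fun n => by
    rw [growthFunction_range_basis, Subgroup.map_bot, Set.ncard_eq_one]
    refine ⟨1, Set.eq_singleton_iff_unique_mem.2 ⟨by simp, fun w hw => ?_⟩⟩
    exact Subgroup.mem_bot.1 hw.1
  simp [IsGrowthRate, h]

/-- The labels of the closed walks in a subdivided Cayley graph form a finitely generated subgroup
whose growth rate is the Perron eigenvalue. -/
lemma mem_fgSubgroupGrowthRates [Fintype ι] [Nontrivial ι] {Q : Type*} [Group Q] [Fintype Q]
    {π : FreeGroup ι →* Q} (hπ : Function.Surjective π) {ℓ : Q × (ι × Bool) → ℕ}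
    (hℓ : ∀ e, 1 ≤ ℓ e) (hrev : ∀ e, ℓ ((cayleyEdges π).rev e) = ℓ e) {lam : ℝ} (hlam : 1 ≤ lam)
    {y : Q × (ι × Bool) → ℝ} (h : (cayleyEdges π).IsPerron ℓ lam y) :
    lam ∈ fgSubgroupGrowthRates (Set.range B) := by
  refine ⟨(spellHom hrev).range.map B.repr.symm.toMonoidHom, fg_map_range_spellHom hrev _, ?_⟩
  have hmap : ((spellHom hrev).range.map B.repr.symm.toMonoidHom).map B.repr.toMonoidHom =
      (spellHom hrev).range := by
    rw [Subgroup.map_map]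
    convert Subgroup.map_id _
    ext; simp
  refine (tendsto_ncard_closedWalkSet hπ h hlam hℓ).congr fun n => ?_
  rw [growthFunction_range_basis, hmap, ncard_range_spellHom hrev hℓ]

/-- Every number in `(1, 2 r - 1]` is a growth rate up to a power between `1` and `1 + ε`. -/
theorem exists_growthRate_between [Fintype ι] [Nontrivial ι] {x ε : ℝ} (hx : 1 < x)
    (hx' : x ≤ 2 * (Fintype.card ι : ℝ) - 1) (hε : 0 < ε) :
    ∃ b ∈ fgSubgroupGrowthRates (Set.range B), x ≤ b ∧ b ≤ x ^ (1 + ε) := by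
  obtain ⟨G, hG⟩ := exists_nat_gt (2 / ε)
  rw [div_lt_iff₀ hε, mul_comm] at hG
  obtain ⟨X, hX, π, hπ⟩ := exists_finite_quotient (α := ι) G
  classical
  have : Fintype π.range := Fintype.ofFinite _
  have hcard : 2 ≤ Fintype.card ι := Fintype.one_lt_card
  have hd : ((2 * Fintype.card ι - 1 : ℕ) : ℝ) = 2 * (Fintype.card ι : ℝ) - 1 := by
    rw [Nat.cast_sub (by omega)]; push_cast; ring
  have hsurj := π.rangeRestrict_surjective
  obtain ⟨ℓ, hℓ, hrev, lam, hlam, ⟨y, hy⟩, hlow, hup⟩ :=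
    EdgeSystem.exists_lengths (cayleyEdges_irreducible hsurj) (by omega) (Real.log_pos hx)
      (by rw [hd]; exact Real.log_le_log (by linarith) hx') hε hG
      fun l hl hlen => nodup_of_isChain
        (fun w hw h => hπ w hw (congrArg Subtype.val h)) l hl hlen.le
  refine ⟨lam, mem_fgSubgroupGrowthRates B hsurj hℓ hrev hlam.le hy, ?_, ?_⟩
  · exact (Real.log_le_log_iff (by linarith) (by linarith)).1 hlow
  · rw [← Real.log_rpow (by linarith)] at hup
    exact (Real.log_le_log_iff (by linarith) (by positivity)).1 hup

lemma mem_closure_growthRates [Fintype ι] [Nontrivial ι] {x : ℝ} (hx : 1 < x)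
    (hx' : x ≤ 2 * (Fintype.card ι : ℝ) - 1) :
    x ∈ closure (fgSubgroupGrowthRates (Set.range B)) := by
  have hε : ∀ n : ℕ, (0 : ℝ) < 1 / ((n : ℝ) + 1) := fun n => by positivity
  choose b hb hlow hup using fun n => exists_growthRate_between B hx hx' (hε n)
  refine mem_closure_of_tendsto (f := b) (b := atTop) ?_ (Eventually.of_forall hb)
  refine tendsto_of_tendsto_of_tendsto_of_le_of_le tendsto_const_nhds ?_ hlow hup
  have h1 : Tendsto (fun n : ℕ => 1 + 1 / ((n : ℝ) + 1)) atTop (𝓝 1) := by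
    simpa using tendsto_one_div_add_atTop_nhds_zero_nat.const_add (1 : ℝ)
  have h2 := (Real.continuousAt_const_rpow (b := 1) (show x ≠ 0 by linarith)).tendsto.comp h1
  simpa [Function.comp_def] using h2

end Basis

end GroupGrowth

/-- `F` is free of rank `r ≥ 1` with free basis `B`, and lengths are taken with respect to `B`.
The growth rates of the finitely generated subgroups lie in `[1, 2r - 1]` and are dense there. -/
theorem theorem1p1 {F : Type*} [Group F] (r : ℕ) (hr : 1 ≤ r) (B : FreeGroupBasis (Fin r) F) :
    GroupGrowth.fgSubgroupGrowthRates (Set.range B) ⊆ Set.Icc (1 : ℝ) (2 * (r : ℝ) - 1) ∧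
      Set.Icc (1 : ℝ) (2 * (r : ℝ) - 1) ⊆
        closure (GroupGrowth.fgSubgroupGrowthRates (Set.range B)) := by
  have : Nonempty (Fin r) := ⟨⟨0, hr⟩⟩
  constructor
  · rintro b ⟨H, -, hb⟩
    simpa using GroupGrowth.mem_Icc_of_isGrowthRate B hb
  · rintro x ⟨hx1, hx2⟩
    rcases hx1.eq_or_lt with rfl | hx
    · exact subset_closure ⟨⊥, Subgroup.FG.bot, GroupGrowth.isGrowthRate_bot B⟩
    · -- Here `1 < 2 * r - 1`, so there are at least two generators.
      have hr2 : 2 ≤ r := by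
        have : (1 : ℝ) < r := by linarith
        exact_mod_cast this
      have : Nontrivial (Fin r) := Fin.nontrivial_iff_two_le.2 hr2
      exact GroupGrowth.mem_closure_growthRates B hx (by simpa using hx2)
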